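/- Let $K, d \ge 1$, let $A \in \mathbb{R}^{m\times d}$, $b \in \mathbb{R}^m$ and let $P = \{x \in \mathbb{R}^d : Ax \le b\}$ be the corresponding polyhedron. For a vector of means $\mu = (\mu_1,\dots,\mu_K) \in (\mathbb{R}^d)^K$ let $F(\mu) = \{i : \mu_i \in P\}$ be the set of feasible arms, say that arm $i$ is dominated by arm $j$ if $\mu_i^c \le \mu_j^c$ for every coordinate $c \in \{1,\dots,d\}$, and let $O^*(\mu)$ be the set of arms of $F(\mu)$ that are not dominated by another arm of $F(\mu)$. An algorithm chooses at each time $t = 1,2,\dots$ an arm $k_t \in \{1,\dots,K\}$ based on the past observations (possibly with randomization) and observes an outcome $X_t \in \mathbb{R}^d$ drawn from the distribution $\nu_{k_t}$ of that arm, independently of the past given $k_t$. It has a stopping time $\tau$ with respect to the filtration $\mathcal{F}_t = \sigma(k_1,X_1,\dots,k_t,X_t,k_{t+1})$ and $\mathcal{F}_t$-measurable recommendations $O_t \subseteq \{1,\dots,K\}$. Let $\mathbb{P}_\nu$ denote the law of $(k_t,X_t)_{t\ge 1}$ when the arms have distributions $\nu = (\nu_1,\dots,\nu_K)$. Let $\mathcal{D}$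 be the class of the normal distributions on $\mathbb{R}^d$ with identity covariance. For $\delta \in (0,1)$, the algorithm is $\delta$-correct for constrained Pareto set identification (cPSI) on $\mathcal{D}^K$ if $\mathbb{P}_\nu(\tau < \infty,\ O_\tau \ne O^*(\mu)) \le \delta$ for every $\nu \in \mathcal{D}^K$, where $\mu$ is the vector of means of $\nu$. Then for every $\delta \in (0,1)$, every algorithm that is $\delta$-correct for cPSI on $\mathcal{D}^K$, and every $\nu \in \mathcal{D}^K$ with means $\mu$, $$\mathbb{E}_\nu[\tau] \ \ge\ T^*(\mu)\,\log\frac{1}{2.4\,\delta},$$ where $$T^*(\mu)^{-1} = \max_{w \in \mathcal{S}_K}\ \inf_{\lambda \in (\mathbb{R}^d)^K :\, O^*(\lambda) \ne O^*(\mu)}\ \sum_{k=1}^K \frac{w_k}{2}\,\|\mu_k - \lambda_k\|^2 ,$$ $\mathcal{S}_K$ is the probability simplex in $\mathbb{R}^K$, $\|\cdot\|$ is the Euclidean norm, and the maximum is attained. Here $\inf\emptyset = \infty$, $1/0 = \infty$, $1/\infty = 0$ and $\infty \cdot 0 = 0$. -/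

import Mathlib

open MeasureTheory ProbabilityTheory
open scoped ENNReal

namespace CPSI

noncomputable section

/-- The space of outcomes `ℝ^d`, with the Euclidean norm. -/
abbrev Outcome (d : ℕ) : Type := EuclideanSpace ℝ (Fin d)

/-- The polyhedron `{x ∈ ℝ^d | A x ≤ b}`. -/
def polyhedron {m d : ℕ} (A : Matrix (Fin m) (Fin d) ℝ) (b : Fin m → ℝ) : Set (Outcome d) :=
  {x | ∀ i, A.mulVec (WithLp.ofLp x) i ≤ b i}

/-- The set of feasible arms of the bandit with means `μ`. -/
def feasible {K d : ℕ} (P : Set (Outcome d)) (μ : Fin K → Outcome d) : Set (Fin K) :=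
  {i | μ i ∈ P}

/-- `x` is dominated by `y`: every coordinate of `x` is at most that of `y`. -/
def Dominated {d : ℕ} (x y : Outcome d) : Prop := ∀ c, x c ≤ y c

/-- The arms of `S` that are not dominated by another arm of `S`. -/
def paretoSet {K d : ℕ} (S : Set (Fin K)) (μ : Fin K → Outcome d) : Set (Fin K) :=
  {i | i ∈ S ∧ ∀ j ∈ S, j ≠ i → ¬ Dominated (μ i) (μ j)}

/-- The Pareto set of the feasible arms. -/
def optSet {K d : ℕ} (P : Set (Outcome d)) (μ : Fin K → Outcome d) : Set (Fin K) :=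
  paretoSet (feasible P μ) μ

/-- The parameters whose Pareto set of feasible arms is not `O`. -/
def alt {K d : ℕ} (P : Set (Outcome d)) (O : Set (Fin K)) : Set (Fin K → Outcome d) :=
  {l | optSet P l ≠ O}

/-- `inf_{λ ∈ Alt(O*(μ))} ∑_k (w_k / 2) ‖μ_k - λ_k‖²`, which is `∞` if there is no alternative. -/
def altCost {K d : ℕ} (P : Set (Outcome d)) (μ : Fin K → Outcome d) (w : Fin K → ℝ) : ℝ≥0∞ :=
  ⨅ l ∈ alt P (optSet P μ), ENNReal.ofReal (∑ k, w k / 2 * ‖μ k - l k‖ ^ 2)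

/-- The characteristic time `T*(μ) ∈ [0, ∞]`, the inverse of the optimal value of `altCost` over
the simplex. -/
def charTime {K d : ℕ} (P : Set (Outcome d)) (μ : Fin K → Outcome d) : ℝ≥0∞ :=
  (⨆ w ∈ stdSimplex ℝ (Fin K), altCost P μ w)⁻¹

/-- Infinite trajectories: `ω n = (k_{n+1}, X_{n+1})` is the `(n+1)`-st arm pulled together with
the outcome that it produced. -/
abbrev Trajectory (K d : ℕ) : Type := ℕ → Fin K × Outcome d

/-- The information `(k_1, X_1, …, k_t, X_t, k_{t+1})` available after `t` observations. -/
def history {K d : ℕ} (t : ℕ) (ω : Trajectory K d) :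
    (Finset.range t → Fin K × Outcome d) × Fin K :=
  (fun s => ω s, (ω t).1)

theorem measurable_history {K d : ℕ} (t : ℕ) : Measurable (history (K := K) (d := d) t) := by
  unfold history
  fun_prop

/-- The filtration `F_t = σ(k_1, X_1, …, k_t, X_t, k_{t+1})`. -/
def historyFiltration (K d : ℕ) :
    Filtration ℕ (inferInstance : MeasurableSpace (Trajectory K d)) where
  seq t := MeasurableSpace.comap (history t) inferInstance
  mono' := by
    intro s t hst
    rcases hst.eq_or_lt with rfl | h
    · exact le_rfl
    let g : (Finset.range t → Fin K × Outcome d) × Fin K →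
        (Finset.range s → Fin K × Outcome d) × Fin K := fun p =>
      (fun i => p.1 ⟨i.1, Finset.mem_range.2 ((Finset.mem_range.1 i.2).trans h)⟩,
        (p.1 ⟨s, Finset.mem_range.2 h⟩).1)
    have hg : Measurable g := by fun_prop
    have hgs : history (K := K) (d := d) s = g ∘ history t := rfl
    change MeasurableSpace.comap (history s) _ ≤ MeasurableSpace.comap (history t) _
    rw [hgs, ← MeasurableSpace.comap_comp]
    exact MeasurableSpace.comap_mono hg.comap_le
  le' t := (measurable_history t).comap_le

/-- A pure exploration algorithm for bandits with `K` arms and outcomes in `ℝ^d`. The sampling rule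
may be randomized. -/
structure Algorithm (K d : ℕ) where
  /-- Law of the first arm `k_1`. -/
  first : Measure (Fin K)
  first_prob : IsProbabilityMeasure first
  /-- Law of the arm `k_{n+2}` given `(k_1, X_1), …, (k_{n+1}, X_{n+1})`. -/
  next : (n : ℕ) → Kernel (Finset.Iic n → Fin K × Outcome d) (Fin K)
  next_markov : ∀ n, IsMarkovKernel (next n)
  /-- Stopping rule `τ`, the number of observations collected. -/
  τ : Trajectory K d → ℕ∞
  isStoppingTime : IsStoppingTime (historyFiltration K d) τ
  /-- Recommendation rule: the guess after `t` observations. -/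
  guess : ℕ → Trajectory K d → Set (Fin K)
  guess_measurable : ∀ t S, MeasurableSet[historyFiltration K d t] {ω | guess t ω = S}

/-- The arms of a bandit as a kernel. -/
def armKernel {K d : ℕ} (ν : Fin K → ProbabilityMeasure (Outcome d)) :
    Kernel (Fin K) (Outcome d) :=
  Kernel.ofFunOfCountable fun k => (ν k : Measure (Outcome d))

instance {K d : ℕ} (ν : Fin K → ProbabilityMeasure (Outcome d)) : IsMarkovKernel (armKernel ν) :=
  ⟨fun k => by change IsProbabilityMeasure (ν k : Measure (Outcome d)); infer_instance⟩

/-- The vector of means of a bandit. -/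
def means {K d : ℕ} (ν : Fin K → ProbabilityMeasure (Outcome d)) : Fin K → Outcome d :=
  fun k => ∫ x, x ∂(ν k : Measure (Outcome d))

namespace Algorithm

variable {K d : ℕ} (alg : Algorithm K d)

instance : IsProbabilityMeasure alg.first := alg.first_prob

instance (n : ℕ) : IsMarkovKernel (alg.next n) := alg.next_markov n

/-- The law `P_ν` of the process `(k_t, X_t)_{t ≥ 1}` on the bandit `ν`: each arm is drawn from
the sampling rule given the past, and then the outcome from the distribution of that arm. -/
def law (ν : Fin K → ProbabilityMeasure (Outcome d)) : Measure (Trajectory K d) :=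
  Kernel.trajMeasure (X := fun _ => Fin K × Outcome d) (alg.first ⊗ₘ armKernel ν)
    (fun n => alg.next n ⊗ₖ Kernel.prodMkLeft _ (armKernel ν))

/-- The sample complexity `E_ν[τ] ∈ [0, ∞]`. -/
def sampleComplexity (ν : Fin K → ProbabilityMeasure (Outcome d)) : ℝ≥0∞ :=
  ∫⁻ ω, (alg.τ ω : ℝ≥0∞) ∂(alg.law ν)

/-- `δ`-correctness for constrained Pareto set identification on the bandits with arms in `D`:
`P_ν(τ < ∞, O_τ ≠ O*(μ)) ≤ δ` for each of them. -/
def IsDeltaCorrect (P : Set (Outcome d)) (D : Set (ProbabilityMeasure (Outcome d))) (δ : ℝ) :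
    Prop :=
  ∀ ν : Fin K → ProbabilityMeasure (Outcome d), (∀ k, ν k ∈ D) →
    alg.law ν {ω | ∃ t : ℕ, alg.τ ω = t ∧ alg.guess t ω ≠ optSet P (means ν)} ≤ ENNReal.ofReal δ

end Algorithm

/-- The multivariate normal distributions on `ℝ^d` with identity covariance. -/
def gaussianClass (d : ℕ) : Set (ProbabilityMeasure (Outcome d)) :=
  {p | ∃ m : Outcome d, (p : Measure (Outcome d)) = multivariateGaussian m 1}

end

end CPSI

/-!
Attainment of the maximum: `altCost` is an infimum of continuous functions of `w`, hence upper
semicontinuous on the compact simplex.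

Lower bound: fix an alternative `l` and the bandit `ν'` of Gaussians with means `l`. On `F_t` the
law of the trajectory on `ν'` has density `exp (-S_t)` with respect to the law on `ν`, with `S_t`
the sum of the log-likelihood ratios of the outcomes, because the sampling rule is the same on both
bandits (`Algorithm.lintegral_history_change`). Cutting the space according to the value of
`min τ n` extends this to events of `F_{min τ n}` (`Algorithm.law_apply_change_stopped`).

Let `E_n` be the event that the algorithm stops by time `n` and recommends `O*(μ)`, let
`a = log ((1 - δ) / δ)` and `φ = a` on `E_n`, `φ = -a` elsewhere. As `l` has another Pareto set,
`E_n` has probability at most `δ` on `ν'`, so that `E_ν[exp (φ - S)] = E_ν'[exp φ] ≤ 1`, where `S`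
is the log-likelihood ratio at `min τ n`. With `1 + x ≤ exp x` this gives `E_ν[φ] ≤ E_ν[S]`, and
Wald's identity bounds `E_ν[S]` by `∑ k, E_ν[N_k] ‖μ k - l k‖² / 2`, with `N_k` the number of pulls
of the arm `k` before `τ`. If `E_ν[τ] < ∞`, then `τ` is finite almost surely and `E_n` increases to
an event of probability at least `1 - δ` on `ν`; in the limit
`(1 - 2δ) a ≤ ∑ k, E_ν[N_k] ‖μ k - l k‖² / 2` (`Algorithm.transportation`). The left hand side is at
least `log (1 / (2.4 δ))` (`log_le_binary_entropy`), and taking `w k = E_ν[N_k] / E_ν[τ]` turns the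
inequality, valid for all alternatives `l`, into the bound on `E_ν[τ]` (`charTime_mul_le`).

Working with `min τ n` and the variational form of the relative entropy of Bernoulli distributions
avoids any integrability question for the log-likelihood ratio at `τ` itself.
-/

namespace CPSI

open scoped RealInnerProductSpace

/-! ### The binary relative entropy -/

/-- The binary relative entropy of `1 - δ` and `δ`, equal to `(1 - 2δ) log ((1 - δ) / δ)`, is at
least `log (1 / (2.4 δ))`. The difference is convex in `δ` with minimum near `1 / 3`, so that the
tangent inequalities of `log` at `1 / 3` and `2 / 3` suffice. -/
theorem log_le_binary_entropy {δ : ℝ} (h0 : 0 < δ) (h1 : δ < 1 / 2) :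
    Real.log (1 / (2.4 * δ)) ≤ (1 - 2 * δ) * Real.log ((1 - δ) / δ) := by
  have h1' : 0 < 1 - δ := by linarith
  have tangent : ∀ x y : ℝ, 0 < x → 0 < y → Real.log y + 1 - y / x ≤ Real.log x := by
    intro x y hx hy
    have := Real.log_le_sub_one_of_pos (div_pos hy hx)
    rw [Real.log_div hy.ne' hx.ne'] at this
    linarith
  have t1 := tangent δ (1 / 3) h0 (by norm_num)
  have t2 := tangent (1 - δ) (2 / 3) h1' (by norm_num)
  have e1 : Real.log (1 / 3) = -Real.log 3 := by rw [one_div, Real.log_inv]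
  have e2 : Real.log (2 / 3) = Real.log 2 - Real.log 3 :=
    Real.log_div (by norm_num) (by norm_num)
  have e3 : Real.log (2.4 : ℝ) = 2 * Real.log 2 + Real.log 3 - Real.log 5 := by
    rw [show (2.4 : ℝ) = 2 ^ 2 * 3 / 5 by norm_num, Real.log_div (by norm_num) (by norm_num),
      Real.log_mul (by norm_num) (by norm_num), Real.log_pow]
    push_cast
    ring
  -- The bound `7 / 3` on `log 5 / log 2` is not sharp enough for the numerical step below.
  have e5 : 31 * Real.log 5 ≤ 72 * Real.log 2 := by
    have := Real.log_le_log (by norm_num) (show (5 : ℝ) ^ 31 ≤ 2 ^ 72 by norm_num)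
    rw [Real.log_pow, Real.log_pow] at this
    exact_mod_cast this
  rw [Real.log_div h1'.ne' h0.ne', one_div, Real.log_inv,
    Real.log_mul (by norm_num) h0.ne', e3]
  have m1 := mul_le_mul_of_nonneg_left t1 (by linarith : 0 ≤ 2 * δ)
  have m2 := mul_le_mul_of_nonneg_left t2 (by linarith : 0 ≤ 1 - 2 * δ)
  rw [e1] at m1
  rw [e2] at m2
  have m1' : 2 * δ * (-Real.log 3 + 1 - 1 / 3 / δ) = 2 * δ * (-Real.log 3 + 1) - 2 / 3 := by
    field_simp
  have key : 0 ≤ (3 - 2 * δ - 72 / 31) * Real.log 2 + 2 * δ - 2 / 3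
      + (1 - 2 * δ) * (1 - 2 / 3 / (1 - δ)) := by
    have hlog : (21 / 31 - 2 * δ) * 0.6931471803 - 1 / 10 ^ 9 ≤ (21 / 31 - 2 * δ) * Real.log 2 := by
      nlinarith [Real.log_two_gt_d9, Real.log_two_lt_d9]
    have hq : 0 ≤ (21 / 31 - 2 * δ) * 0.6931471803 - 1 / 10 ^ 9 + 2 * δ - 2 / 3
        + (1 - 2 * δ) * (1 - 2 / 3 / (1 - δ)) := by
      rw [← mul_nonneg_iff_of_pos_right h1']
      have : (1 - 2 * δ) * (1 - 2 / 3 / (1 - δ)) * (1 - δ) = (1 - 2 * δ) * (1 / 3 - δ) := by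
        field_simp
        ring
      nlinarith [sq_nonneg (δ - 0.32)]
    linarith
  nlinarith

/-! ### Likelihood ratios of Gaussian measures -/

theorem stdGaussian_map_const_add {d : ℕ} (h : Outcome d) :
    (stdGaussian (Outcome d)).map (fun x ↦ h + x) = multivariateGaussian h 1 := by
  simp [multivariateGaussian]

/-- The Cameron–Martin formula for the standard Gaussian measure. The characteristic function of
the right hand side factors into moment generating functions of real Gaussians at complex
points. -/
theorem multivariateGaussian_one_eq_withDensity_stdGaussian {d : ℕ} (h : Outcome d) :
    multivariateGaussian h 1 = (stdGaussian (Outcome d)).withDensity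
      (fun x ↦ ENNReal.ofReal (Real.exp (⟪h, x⟫ - ‖h‖ ^ 2 / 2))) := by
  have key : ∀ t : Outcome d, ∫ x, Complex.exp (((⟪h, x⟫ - ‖h‖ ^ 2 / 2 : ℝ) : ℂ)
      + (⟪x, t⟫ : ℂ) * Complex.I) ∂(stdGaussian (Outcome d))
      = Complex.exp (⟪t, h⟫ * Complex.I - ‖t‖ ^ 2 / 2) := by
    intro t
    rw [← map_pi_eq_stdGaussian, integral_map (by fun_prop)
      (by apply Measurable.aestronglyMeasurable; fun_prop)]
    have hfac : ∀ x : Fin d → ℝ, Complex.exp (((⟪h, WithLp.toLp 2 x⟫ - ‖h‖ ^ 2 / 2 : ℝ) : ℂ)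
      + (⟪WithLp.toLp 2 x, t⟫ : ℂ) * Complex.I) = Complex.exp (-(‖h‖ ^ 2 / 2 : ℂ)) *
        ∏ i, Complex.exp ((h i + t i * Complex.I) * x i) := by
      intro x
      rw [← Complex.exp_sum, ← Complex.exp_add]
      congr 1
      simp only [PiLp.inner_apply, RCLike.inner_apply, conj_trivial]
      push_cast
      simp only [add_mul, Finset.sum_add_distrib, Finset.sum_mul]
      rw [sub_eq_neg_add, add_assoc]
      congr 2
      · exact Finset.sum_congr rfl fun i _ ↦ mul_comm _ _
      · exact Finset.sum_congr rfl fun i _ ↦ by ring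
    simp_rw [hfac]
    rw [integral_const_mul, integral_fintype_prod_eq_prod
      (fun i (y : ℝ) ↦ Complex.exp ((h i + t i * Complex.I) * y))]
    have hz : ∀ z : ℂ, ∫ y : ℝ, Complex.exp (z * y) ∂(gaussianReal 0 1)
        = Complex.exp (z ^ 2 / 2) := by
      intro z
      have := complexMGF_id_gaussianReal (μ := 0) (v := 1) z
      simpa [complexMGF] using this
    simp_rw [hz]
    rw [← Complex.exp_sum, ← Complex.exp_add]
    congr 1
    have n1 := EuclideanSpace.real_norm_sq_eq h
    have n2 := EuclideanSpace.real_norm_sq_eq t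
    have n1' : (‖h‖ ^ 2 : ℂ) = ∑ i, (h i : ℂ) ^ 2 := by exact_mod_cast n1
    have n2' : (‖t‖ ^ 2 : ℂ) = ∑ i, (t i : ℂ) ^ 2 := by exact_mod_cast n2
    have n3 : (⟪t, h⟫ : ℂ) = ∑ i, (t i : ℂ) * h i := by
      simp [PiLp.inner_apply, mul_comm]
    rw [n1', n2', n3]
    simp only [add_sq, mul_pow, Complex.I_sq, add_div, Finset.sum_add_distrib, Finset.sum_div,
      Finset.sum_mul]
    rw [← sub_eq_zero]
    rw [Finset.sum_congr rfl fun i _ ↦ show 2 * (h i : ℂ) * (t i * Complex.I) / 2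
      = t i * h i * Complex.I by ring, Finset.sum_congr rfl fun i _ ↦
      show (t i : ℂ) ^ 2 * -1 / 2 = - ((t i : ℂ) ^ 2 / 2) by ring, Finset.sum_neg_distrib]
    ring
  have hm : Measurable fun x : Outcome d ↦
      ENNReal.ofReal (Real.exp (⟪h, x⟫ - ‖h‖ ^ 2 / 2)) := by fun_prop
  have hfin : IsFiniteMeasure ((stdGaussian (Outcome d)).withDensity
      (fun x ↦ ENNReal.ofReal (Real.exp (⟪h, x⟫ - ‖h‖ ^ 2 / 2)))) := by
    refine isFiniteMeasure_withDensity_ofReal (Integrable.hasFiniteIntegral ?_)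
    have h0 := key 0
    by_contra hni
    have : ¬ Integrable (fun x : Outcome d ↦
        ((Real.exp (⟪h, x⟫ - ‖h‖ ^ 2 / 2) : ℝ) : ℂ)) (stdGaussian (Outcome d)) := by
      intro hc
      exact hni (by simpa only [RCLike.re_to_complex, Complex.ofReal_re] using hc.re)
    rw [integral_undef] at h0
    · exact Complex.exp_ne_zero _ h0.symm
    · simpa using this
  apply Measure.ext_of_charFun
  ext t
  rw [charFun_multivariateGaussian Matrix.PosSemidef.one, charFun_apply,
    integral_withDensity_eq_integral_toReal_smul hm (by simp)]
  have := key t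
  simp only [ENNReal.toReal_ofReal (Real.exp_nonneg _), Complex.real_smul, Complex.ofReal_exp,
    ← Complex.exp_add, Matrix.one_mulVec]
  rw [this]
  congr 2
  have n2 := EuclideanSpace.real_norm_sq_eq t
  have n2' : (‖t‖ ^ 2 : ℂ) = ∑ i, (t i : ℂ) ^ 2 := by exact_mod_cast n2
  rw [n2']
  simp [dotProduct, sq]

/-- The log-likelihood ratio at `x` of the Gaussians on `ℝ^d` with identity covariance and means
`u` and `v`. -/
noncomputable def gaussianLLR {d : ℕ} (u v x : Outcome d) : ℝ :=
  ⟪u - v, x - u⟫ + ‖u - v‖ ^ 2 / 2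

@[fun_prop]
theorem measurable_gaussianLLR {d : ℕ} (u v : Outcome d) : Measurable (gaussianLLR u v) := by
  unfold gaussianLLR
  fun_prop

/-- The Cameron–Martin formula between two Gaussians with identity covariance. -/
theorem multivariateGaussian_one_eq_withDensity {d : ℕ} (u v : Outcome d) :
    multivariateGaussian v 1 = (multivariateGaussian u 1).withDensity
      (fun x ↦ ENNReal.ofReal (Real.exp (-gaussianLLR u v x))) := by
  have hm : Measurable (fun x ↦ ENNReal.ofReal (Real.exp (-gaussianLLR u v x))) := by fun_prop
  refine Measure.ext_of_lintegral _ fun f hf ↦ ?_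
  have h1 : multivariateGaussian v 1 = (multivariateGaussian (v - u) 1).map (fun x ↦ u + x) := by
    rw [← stdGaussian_map_const_add, ← stdGaussian_map_const_add,
      Measure.map_map (by fun_prop) (by fun_prop)]
    congr 1
    ext1 x
    simp [← add_assoc]
  rw [h1, lintegral_map hf (by fun_prop), multivariateGaussian_one_eq_withDensity_stdGaussian,
    lintegral_withDensity_eq_lintegral_mul _ (by fun_prop) (by fun_prop),
    lintegral_withDensity_eq_lintegral_mul _ hm hf, ← stdGaussian_map_const_add u,
    lintegral_map (hm.mul hf) (by fun_prop)]
  refine lintegral_congr fun x ↦ ?_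
  have : -gaussianLLR u v (u + x) = ⟪v - u, x⟫ - ‖v - u‖ ^ 2 / 2 := by
    rw [gaussianLLR, add_sub_cancel_left, ← neg_sub v u, inner_neg_left, norm_neg]
    ring
  simp only [Pi.mul_apply, this]

theorem integrable_gaussianLLR {d : ℕ} (u v : Outcome d) :
    Integrable (gaussianLLR u v) (multivariateGaussian u 1) := by
  have h : Integrable (fun x : Outcome d ↦ x) (multivariateGaussian u 1) :=
    IsGaussian.integrable_fun_id
  exact ((h.sub (integrable_const u)).const_inner (u - v)).add (integrable_const _)

/-- The relative entropy of two Gaussians with identity covariance. -/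
theorem integral_gaussianLLR {d : ℕ} (u v : Outcome d) :
    ∫ x, gaussianLLR u v x ∂(multivariateGaussian u 1) = ‖u - v‖ ^ 2 / 2 := by
  have h : Integrable (fun x : Outcome d ↦ x) (multivariateGaussian u 1) :=
    IsGaussian.integrable_fun_id
  have h' : Integrable (fun x : Outcome d ↦ x - u) (multivariateGaussian u 1) :=
    h.sub (integrable_const u)
  unfold gaussianLLR
  rw [integral_add (h'.const_inner (u - v)) (integrable_const _), integral_inner h',
    integral_sub h (integrable_const u)]
  simp

end CPSI

/-! ### The law of a trajectory and its change between two bandits -/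

namespace CPSI

namespace Algorithm

variable {K d : ℕ} (alg : Algorithm K d) (ν : Fin K → ProbabilityMeasure (Outcome d))

instance : IsProbabilityMeasure (alg.law ν) := by
  unfold law
  infer_instance

theorem law_map_eval_zero : (alg.law ν).map (fun ω ↦ ω 0) = alg.first ⊗ₘ armKernel ν := by
  have h : (fun ω : Trajectory K d ↦ ω 0) =
      (MeasurableEquiv.piUnique (fun _ : Finset.Iic 0 ↦ Fin K × Outcome d)) ∘
        Preorder.frestrictLe (π := fun _ ↦ Fin K × Outcome d) 0 := rfl
  rw [h, ← Measure.map_map (by fun_prop) (by fun_prop), law, Kernel.trajMeasure,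
    Measure.map_comp _ _ (by fun_prop), Kernel.traj_map_frestrictLe, Kernel.partialTraj_self,
    Measure.id_comp, MeasurableEquiv.map_map_symm]

/-- Given the first `t + 1` pairs, the next arm is drawn from the sampling rule and its outcome from
that arm. -/
theorem lintegral_law_succ (t : ℕ)
    {g : (Finset.Iic t → Fin K × Outcome d) × Fin K × Outcome d → ℝ≥0∞}
    (hg : Measurable g) :
    ∫⁻ ω, g (Preorder.frestrictLe t ω, ω (t + 1)) ∂(alg.law ν) =
      ∫⁻ ω, ∫⁻ k, ∫⁻ x, g (Preorder.frestrictLe t ω, k, x) ∂(ν k : Measure (Outcome d))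
        ∂(alg.next t (Preorder.frestrictLe t ω)) ∂(alg.law ν) := by
  have h := Kernel.map_frestrictLe_trajMeasure_compProd_eq_map_trajMeasure
    (X := fun _ ↦ Fin K × Outcome d) (μ₀ := alg.first ⊗ₘ armKernel ν)
    (κ := fun n => alg.next n ⊗ₖ Kernel.prodMkLeft _ (armKernel ν)) (a := t)
  change Measure.map _ (alg.law ν) ⊗ₘ _ = Measure.map _ (alg.law ν) at h
  rw [← lintegral_map (μ := alg.law ν) (f := g)
    (g := fun ω ↦ (Preorder.frestrictLe t ω, ω (t + 1))) hg (by fun_prop), ← h,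
    Measure.lintegral_compProd hg, lintegral_map _ (by fun_prop)]
  · refine lintegral_congr fun ω ↦ ?_
    rw [Kernel.lintegral_compProd _ _ _ (by fun_prop)]
    rfl
  · exact hg.lintegral_kernel_prod_right'

theorem lintegral_eval_zero {f : Fin K × Outcome d → ℝ≥0∞} (hf : Measurable f) :
    ∫⁻ ω, f (ω 0) ∂(alg.law ν) =
      ∫⁻ k, ∫⁻ x, f (k, x) ∂(ν k : Measure (Outcome d)) ∂alg.first := by
  rw [← lintegral_map (μ := alg.law ν) (g := fun ω ↦ ω 0) hf (by fun_prop), law_map_eval_zero,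
    Measure.lintegral_compProd hf]
  rfl

theorem measurable_lintegral_arm {α : Type*} [MeasurableSpace α] {g : α → Fin K}
    (hg : Measurable g) {f : α × Outcome d → ℝ≥0∞} (hf : Measurable f) :
    Measurable fun a ↦ ∫⁻ x, f (a, x) ∂(ν (g a) : Measure (Outcome d)) :=
  hf.lintegral_kernel_prod_right' (κ := (armKernel ν).comap g hg)

/-- Given the past and the current arm, the current outcome is drawn from that arm. -/
theorem lintegral_history_outcome (t : ℕ)
    {f : ((Finset.range t → Fin K × Outcome d) × Fin K) × Outcome d → ℝ≥0∞}
    (hf : Measurable f) :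
    ∫⁻ ω, f (history t ω, (ω t).2) ∂(alg.law ν) =
      ∫⁻ ω, ∫⁻ x, f (history t ω, x) ∂(ν (ω t).1 : Measure (Outcome d)) ∂(alg.law ν) := by
  rcases t with _ | t
  · let e : Fin K × Outcome d → ((Finset.range 0 → Fin K × Outcome d) × Fin K) × Outcome d :=
      fun p ↦ ((fun i ↦ absurd i.2 (by simp), p.1), p.2)
    have he : Measurable e := by
      refine Measurable.prodMk (Measurable.prodMk ?_ (by fun_prop)) (by fun_prop)
      exact measurable_pi_lambda _ fun i ↦ absurd i.2 (by simp)
    have hh (ω : Trajectory K d) : history 0 ω = (e (ω 0)).1 :=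
      Prod.ext (funext fun i ↦ absurd i.2 (by simp)) rfl
    have h2 : Measurable fun p : Fin K × Outcome d ↦
        ∫⁻ x, f ((e p).1, x) ∂(ν p.1 : Measure (Outcome d)) :=
      measurable_lintegral_arm ν measurable_fst (f := fun q ↦ f ((e q.1).1, q.2)) (by fun_prop)
    simp_rw [hh]
    refine (alg.lintegral_eval_zero ν (hf.comp he)).trans ?_
    rw [alg.lintegral_eval_zero ν h2]
    simp only [e, lintegral_const, measure_univ, mul_one]
    rfl
  · let e : (Finset.Iic t → Fin K × Outcome d) × Fin K × Outcome d →
        ((Finset.range (t + 1) → Fin K × Outcome d) × Fin K) × Outcome d :=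
      fun p ↦ ((fun i ↦ p.1 ⟨i, Finset.mem_Iic.2 (Nat.lt_succ_iff.1 (Finset.mem_range.1 i.2))⟩,
        p.2.1), p.2.2)
    have he : Measurable e := by fun_prop
    have h2 : Measurable fun p : (Finset.Iic t → Fin K × Outcome d) × Fin K × Outcome d ↦
        ∫⁻ x, f ((e p).1, x) ∂(ν p.2.1 : Measure (Outcome d)) :=
      measurable_lintegral_arm ν (by fun_prop) (f := fun q ↦ f ((e q.1).1, q.2)) (by fun_prop)
    refine (alg.lintegral_law_succ ν t (hf.comp he)).trans ?_
    refine Eq.trans ?_ (alg.lintegral_law_succ ν t h2).symm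
    simp [e]

/-- Given the past, the next arm is drawn from the sampling rule. -/
theorem lintegral_history_succ (t : ℕ)
    {f : (Finset.range (t + 1) → Fin K × Outcome d) × Fin K → ℝ≥0∞} (hf : Measurable f) :
    ∫⁻ ω, f (history (t + 1) ω) ∂(alg.law ν) =
      ∫⁻ ω, ∫⁻ k, f (fun s ↦ ω s, k) ∂(alg.next t (Preorder.frestrictLe t ω)) ∂(alg.law ν) := by
  let e : (Finset.Iic t → Fin K × Outcome d) × Fin K × Outcome d →
      (Finset.range (t + 1) → Fin K × Outcome d) × Fin K :=
    fun p ↦ (fun i ↦ p.1 ⟨i, Finset.mem_Iic.2 (Nat.lt_succ_iff.1 (Finset.mem_range.1 i.2))⟩, p.2.1)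
  have he : Measurable e := by fun_prop
  refine (alg.lintegral_law_succ ν t (hf.comp he)).trans ?_
  simp [e]

theorem law_map_history_outcome (t : ℕ) :
    (alg.law ν).map (fun ω ↦ (history t ω, (ω t).2)) =
      (alg.law ν).map (history t) ⊗ₘ (armKernel ν).comap Prod.snd measurable_snd := by
  refine Measure.ext_of_lintegral _ fun f hf ↦ ?_
  have := measurable_history (K := K) (d := d) t
  rw [lintegral_map hf (by fun_prop), lintegral_history_outcome _ _ _ hf,
    Measure.lintegral_compProd hf, lintegral_map hf.lintegral_kernel_prod_right' (by fun_prop)]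
  rfl

/-- Change of measure: if the arms of `ν'` have densities `exp (-ℓ k)` with respect to those of
`ν`, then on `F_t` the law on `ν'` has the density `exp (-∑ s < t, ℓ (k_s, X_s))` with respect to
the law on `ν`. -/
theorem lintegral_history_change (ν' : Fin K → ProbabilityMeasure (Outcome d))
    {ℓ : Fin K × Outcome d → ℝ} (hℓ : Measurable ℓ)
    (hν' : ∀ k, (ν' k : Measure (Outcome d)) = (ν k : Measure (Outcome d)).withDensity
      fun x ↦ ENNReal.ofReal (Real.exp (-ℓ (k, x))))
    (t : ℕ) {f : (Finset.range t → Fin K × Outcome d) × Fin K → ℝ≥0∞} (hf : Measurable f) :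
    ∫⁻ ω, f (history t ω) ∂(alg.law ν') =
      ∫⁻ ω, ENNReal.ofReal (Real.exp (-∑ s ∈ Finset.range t, ℓ (ω s))) * f (history t ω)
        ∂(alg.law ν) := by
  induction t with
  | zero =>
    let e : Fin K × Outcome d → (Finset.range 0 → Fin K × Outcome d) × Fin K :=
      fun p ↦ (fun i ↦ absurd i.2 (by simp), p.1)
    have he : Measurable e := by
      refine Measurable.prodMk ?_ (by fun_prop)
      exact measurable_pi_lambda _ fun i ↦ absurd i.2 (by simp)
    have hh (ω : Trajectory K d) : history 0 ω = e (ω 0) :=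
      Prod.ext (funext fun i ↦ absurd i.2 (by simp)) rfl
    simp only [hh, Finset.range_zero, Finset.sum_empty, neg_zero, Real.exp_zero,
      ENNReal.ofReal_one, one_mul]
    rw [alg.lintegral_eval_zero ν (f := fun p ↦ f (e p)) (by fun_prop),
      alg.lintegral_eval_zero ν' (f := fun p ↦ f (e p)) (by fun_prop)]
    simp [e]
  | succ t ih =>
    -- `r` appends to the history at time `t` the outcome of the arm that it ends with.
    let r : ((Finset.range t → Fin K × Outcome d) × Fin K) × Outcome d →
        Finset.range (t + 1) → Fin K × Outcome d := fun p i ↦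
      if h : (i : ℕ) ∈ Finset.range t then p.1.1 ⟨i, h⟩ else (p.1.2, p.2)
    have hr : Measurable r := by
      refine measurable_pi_lambda _ fun i ↦ ?_
      by_cases h : (i : ℕ) ∈ Finset.range t
      · simp only [r, h, dif_pos]; fun_prop
      · simp only [r, h, dif_neg, not_false_eq_true]; fun_prop
    have hrω (ω : Trajectory K d) :
        r (history t ω, (ω t).2) = fun s : Finset.range (t + 1) ↦ ω s := by
      ext1 i
      by_cases h : (i : ℕ) ∈ Finset.range t
      · simp only [r, h, dif_pos]; rfl
      · have hi : (i : ℕ) = t := by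
          have := Finset.mem_range.1 i.2
          rw [Finset.mem_range] at h
          omega
        simp only [r, h, dif_neg, not_false_eq_true]
        rw [hi]
        rfl
    let c : (Finset.range (t + 1) → Fin K × Outcome d) → Finset.Iic t → Fin K × Outcome d :=
      fun y i ↦ y ⟨i, Finset.mem_range.2 (Nat.lt_succ_iff.2 (Finset.mem_Iic.1 i.2))⟩
    have hc : Measurable c := by fun_prop
    let G : (Finset.range (t + 1) → Fin K × Outcome d) → ℝ≥0∞ := fun y ↦
      ∫⁻ k, f (y, k) ∂(alg.next t (c y))
    have hG : Measurable G := hf.lintegral_kernel_prod_right' (κ := (alg.next t).comap c hc)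
    let L : (Finset.range (t + 1) → Fin K × Outcome d) → ℝ≥0∞ := fun y ↦
      ENNReal.ofReal (Real.exp (-∑ s, ℓ (y s)))
    have hL : Measurable L := by fun_prop
    let L' : ((Finset.range t → Fin K × Outcome d) × Fin K) → ℝ≥0∞ := fun h ↦
      ENNReal.ofReal (Real.exp (-∑ s, ℓ (h.1 s)))
    have hL' : Measurable L' := by fun_prop
    have hLω (ω : Trajectory K d) : ENNReal.ofReal (Real.exp (-∑ s ∈ Finset.range (t + 1), ℓ (ω s)))
        = L (fun s ↦ ω s) := by
      simp only [L]
      rw [Finset.sum_coe_sort (Finset.range (t + 1)) fun s ↦ ℓ (ω s)]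
    have hL'ω (ω : Trajectory K d) : ENNReal.ofReal (Real.exp (-∑ s ∈ Finset.range t, ℓ (ω s)))
        = L' (history t ω) := by
      simp only [L', history]
      rw [Finset.sum_coe_sort (Finset.range t) fun s ↦ ℓ (ω s)]
    have hLL' (h : (Finset.range t → Fin K × Outcome d) × Fin K) (x : Outcome d) :
        L (r (h, x)) = L' h * ENNReal.ofReal (Real.exp (-ℓ (h.2, x))) := by
      let ω : Trajectory K d := fun i ↦
        if hi : i ∈ Finset.range t then h.1 ⟨i, hi⟩ else (h.2, x)
      have h1 : h = history t ω := by
        refine Prod.ext (funext fun i ↦ ?_) ?_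
        · simp only [history, ω, i.2, dif_pos]
        · simp [history, ω]
      have h2 : x = (ω t).2 := by simp [ω]
      have h3 : h.2 = (ω t).1 := by simp [ω]
      rw [h3, h1, h2, hrω, ← hLω ω, ← hL'ω, ← ENNReal.ofReal_mul (Real.exp_nonneg _),
        ← Real.exp_add, Finset.sum_range_succ, neg_add]
    have key (F : (Finset.range (t + 1) → Fin K × Outcome d) → ℝ≥0∞) (hF : Measurable F)
        (ρ : Fin K → ProbabilityMeasure (Outcome d)) :
        ∫⁻ ω, F (fun s ↦ ω s) ∂(alg.law ρ) = ∫⁻ ω, ∫⁻ x, F (r (history t ω, x))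
          ∂(ρ (ω t).1 : Measure (Outcome d)) ∂(alg.law ρ) := by
      have := alg.lintegral_history_outcome ρ t (hF.comp hr)
      simpa only [Function.comp_apply, hrω] using this
    have hin (k : Fin K) (h : (Finset.range t → Fin K × Outcome d) × Fin K) (hk : h.2 = k) :
        ∫⁻ x, G (r (h, x)) ∂(ν' k : Measure (Outcome d)) =
          ∫⁻ x, ENNReal.ofReal (Real.exp (-ℓ (k, x))) * G (r (h, x))
            ∂(ν k : Measure (Outcome d)) := by
      rw [hν', lintegral_withDensity_eq_lintegral_mul _ (by fun_prop) (by fun_prop)]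
      rfl
    have hA : Measurable fun h : (Finset.range t → Fin K × Outcome d) × Fin K ↦
        ∫⁻ x, G (r (h, x)) ∂(ν' h.2 : Measure (Outcome d)) :=
      measurable_lintegral_arm ν' measurable_snd (hG.comp hr)
    rw [alg.lintegral_history_succ ν' t hf]
    calc ∫⁻ ω, G (fun s ↦ ω s) ∂(alg.law ν')
        = ∫⁻ ω, ∫⁻ x, G (r (history t ω, x)) ∂(ν' (history t ω).2 : Measure (Outcome d))
          ∂(alg.law ν') := key G hG ν'
      _ = ∫⁻ ω, ∫⁻ x, (L * G) (r (history t ω, x)) ∂(ν (ω t).1 : Measure (Outcome d))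
          ∂(alg.law ν) := by
        rw [ih hA]
        refine lintegral_congr fun ω ↦ ?_
        rw [hin _ _ rfl, hL'ω, ← lintegral_const_mul _ (by fun_prop)]
        refine lintegral_congr fun x ↦ ?_
        rw [Pi.mul_apply, hLL', mul_assoc]
      _ = ∫⁻ ω, (L * G) (fun s ↦ ω s) ∂(alg.law ν) := (key (L * G) (hL.mul hG) ν).symm
      _ = _ := by
        have := alg.lintegral_history_succ ν t (f := fun p ↦ L p.1 * f p) (by fun_prop)
        simp only [hLω]
        refine Eq.trans ?_ this.symm
        refine lintegral_congr fun ω ↦ ?_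
        exact (lintegral_const_mul _ (by fun_prop)).symm

end Algorithm
end CPSI

/-! ### Change of measure up to the stopping time -/

namespace CPSI

namespace Algorithm

variable {K d : ℕ} (alg : Algorithm K d) (ν : Fin K → ProbabilityMeasure (Outcome d))

/-- Change of measure for the events of `F_t`. -/
theorem law_apply_change (ν' : Fin K → ProbabilityMeasure (Outcome d))
    {ℓ : Fin K × Outcome d → ℝ} (hℓ : Measurable ℓ)
    (hν' : ∀ k, (ν' k : Measure (Outcome d)) = (ν k : Measure (Outcome d)).withDensity
      fun x ↦ ENNReal.ofReal (Real.exp (-ℓ (k, x))))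
    (t : ℕ) {B : Set (Trajectory K d)} (hB : MeasurableSet[historyFiltration K d t] B) :
    alg.law ν' B =
      ∫⁻ ω in B, ENNReal.ofReal (Real.exp (-∑ s ∈ Finset.range t, ℓ (ω s))) ∂(alg.law ν) := by
  have hBm := (historyFiltration K d).le t B hB
  obtain ⟨S, hS, rfl⟩ := hB
  have h := alg.lintegral_history_change ν ν' hℓ hν' t (f := S.indicator 1)
    (measurable_one.indicator hS)
  have e (ω : Trajectory K d) : (S.indicator 1 (history t ω) : ℝ≥0∞) =
      (history t ⁻¹' S).indicator 1 ω := rfl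
  simp only [e] at h
  rw [lintegral_indicator_one hBm] at h
  rw [h, ← lintegral_indicator hBm]
  refine lintegral_congr fun ω ↦ ?_
  by_cases hω : ω ∈ history t ⁻¹' S <;> simp [hω]

/-- The log-likelihood ratio of the observations made before time `min τ n`. -/
noncomputable def stoppedLLR (ℓ : Fin K × Outcome d → ℝ) (n : ℕ) (ω : Trajectory K d) : ℝ :=
  ∑ s ∈ Finset.range n, {ω : Trajectory K d | (s : ℕ∞) < alg.τ ω}.indicator (fun ω ↦ ℓ (ω s)) ω

theorem measurableSet_lt_stop (s : ℕ) :
    MeasurableSet[historyFiltration K d s] {ω : Trajectory K d | (s : ℕ∞) < alg.τ ω} :=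
  alg.isStoppingTime.measurableSet_gt s

theorem measurableSet_stop_eq (t : ℕ) :
    MeasurableSet[historyFiltration K d t] {ω : Trajectory K d | alg.τ ω = t} :=
  alg.isStoppingTime.measurableSet_eq_of_countable t

theorem measurableSet_min_stop_eq {n t : ℕ} (ht : t ≤ n) :
    MeasurableSet[historyFiltration K d t] {ω : Trajectory K d | min (alg.τ ω) n = t} := by
  rcases ht.lt_or_eq with h | rfl
  · convert alg.measurableSet_stop_eq t using 1
    ext ω
    have : (t : ℕ∞) < n := by exact_mod_cast h
    simp only [Set.mem_ofPred_eq]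
    constructor
    · intro hm
      rcases min_choice (alg.τ ω) n with h' | h'
      · rw [← h', hm]
      · exact absurd (h'.symm.trans hm) this.ne'
    · intro hm
      rw [hm, min_eq_left this.le]
  · convert alg.isStoppingTime.measurableSet_ge_of_countable t using 1
    ext ω
    exact min_eq_right_iff

@[fun_prop]
theorem measurable_stoppedLLR {ℓ : Fin K × Outcome d → ℝ} (hℓ : Measurable ℓ) (n : ℕ) :
    Measurable (alg.stoppedLLR ℓ n) := by
  unfold stoppedLLR
  refine Finset.measurable_sum _ fun s _ ↦ Measurable.indicator (by fun_prop) ?_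
  exact (historyFiltration K d).le s _ (alg.measurableSet_lt_stop s)

theorem stoppedLLR_eq_sum (ℓ : Fin K × Outcome d → ℝ) {n t : ℕ} {ω : Trajectory K d}
    (h : min (alg.τ ω) n = t) :
    alg.stoppedLLR ℓ n ω = ∑ s ∈ Finset.range t, ℓ (ω s) := by
  have htn : t ≤ n := by exact_mod_cast h ▸ min_le_right (alg.τ ω) (n : ℕ∞)
  unfold stoppedLLR
  rw [← Finset.sum_subset (Finset.range_mono htn)]
  · refine Finset.sum_congr rfl fun s hs ↦ Set.indicator_of_mem ?_ _
    have : (s : ℕ∞) < t := by exact_mod_cast Finset.mem_range.1 hs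
    exact this.trans_le (h ▸ min_le_left _ _)
  · intro s hsn hst
    refine Set.indicator_of_notMem (fun hs ↦ hst ?_) _
    have h1 : (s : ℕ∞) < n := by exact_mod_cast Finset.mem_range.1 hsn
    have : (s : ℕ∞) < t := h ▸ lt_min hs h1
    exact Finset.mem_range.2 (by exact_mod_cast this)

/-- Change of measure up to the stopping time `min τ n`. -/
theorem law_apply_change_stopped (ν' : Fin K → ProbabilityMeasure (Outcome d))
    {ℓ : Fin K × Outcome d → ℝ} (hℓ : Measurable ℓ)
    (hν' : ∀ k, (ν' k : Measure (Outcome d)) = (ν k : Measure (Outcome d)).withDensity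
      fun x ↦ ENNReal.ofReal (Real.exp (-ℓ (k, x))))
    (n : ℕ) {C : Set (Trajectory K d)}
    (hC : ∀ t ≤ n, MeasurableSet[historyFiltration K d t] ({ω | min (alg.τ ω) n = t} ∩ C)) :
    alg.law ν' C =
      ∫⁻ ω in C, ENNReal.ofReal (Real.exp (-alg.stoppedLLR ℓ n ω)) ∂(alg.law ν) := by
  have hU : C = ⋃ t ∈ Finset.range (n + 1), ({ω | min (alg.τ ω) n = t} ∩ C) := by
    ext ω
    simp only [Finset.mem_range, Set.mem_iUnion, Set.mem_inter_iff, Set.mem_ofPred_eq,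
      exists_prop, exists_and_right, ← and_assoc]
    refine ⟨fun h ↦ ⟨?_, h⟩, fun h ↦ h.2⟩
    have hne : min (alg.τ ω) n ≠ ⊤ := ne_top_of_le_ne_top (ENat.natCast_ne_top n) (min_le_right _ _)
    obtain ⟨t, ht⟩ := ENat.ne_top_iff_exists.1 hne
    refine ⟨t, ?_, ht.symm⟩
    have : (t : ℕ∞) ≤ n := ht ▸ min_le_right _ _
    have : t ≤ n := by exact_mod_cast this
    omega
  have hd : Set.PairwiseDisjoint (↑(Finset.range (n + 1)))
      fun t : ℕ ↦ {ω | min (alg.τ ω) n = t} ∩ C := by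
    intro i _ j _ hij
    refine Set.disjoint_left.2 fun ω h1 h2 ↦ hij ?_
    exact_mod_cast h1.1.symm.trans h2.1
  have hm : ∀ t ∈ Finset.range (n + 1), MeasurableSet ({ω | min (alg.τ ω) n = t} ∩ C) :=
    fun t ht ↦ (historyFiltration K d).le t _ (hC t (Finset.mem_range_succ_iff.1 ht))
  calc alg.law ν' C
      = ∑ t ∈ Finset.range (n + 1), alg.law ν' ({ω | min (alg.τ ω) n = t} ∩ C) := by
        conv_lhs => rw [hU]
        exact measure_biUnion_finset hd hm
    _ = ∑ t ∈ Finset.range (n + 1), ∫⁻ ω in {ω | min (alg.τ ω) n = t} ∩ C,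
          ENNReal.ofReal (Real.exp (-alg.stoppedLLR ℓ n ω)) ∂(alg.law ν) := by
        refine Finset.sum_congr rfl fun t ht ↦ ?_
        rw [alg.law_apply_change ν ν' hℓ hν' t (hC t (Finset.mem_range_succ_iff.1 ht))]
        refine setLIntegral_congr_fun (hm t ht) fun ω hω ↦ ?_
        rw [alg.stoppedLLR_eq_sum ℓ hω.1]
    _ = _ := by
        conv_rhs => rw [hU]
        exact (lintegral_biUnion_finset hd hm _).symm

/-! ### Wald's identity and the number of pulls -/

/-- For an event `B` of `F_s`, which precedes the outcome with index `s`, the log-likelihood ratio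
of that outcome can be replaced on `B` by its mean given the arm. -/
theorem integrable_integral_outcome {ℓ : Fin K × Outcome d → ℝ} (hℓ : Measurable ℓ)
    (hint : ∀ k, Integrable (fun x ↦ ℓ (k, x)) (ν k : Measure (Outcome d)))
    (s : ℕ) {B : Set (Trajectory K d)} (hB : MeasurableSet[historyFiltration K d s] B) :
    Integrable (B.indicator fun ω ↦ ℓ (ω s)) (alg.law ν) ∧
      ∫ ω, B.indicator (fun ω ↦ ℓ (ω s)) ω ∂(alg.law ν) =
        ∫ ω, B.indicator
          (fun ω ↦ ∫ x, ℓ ((ω s).1, x) ∂(ν (ω s).1 : Measure (Outcome d))) ω ∂(alg.law ν) := by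
  obtain ⟨S, hS, rfl⟩ := hB
  have hh := measurable_history (K := K) (d := d) s
  let f : ((Finset.range s → Fin K × Outcome d) × Fin K) × Outcome d → ℝ :=
    fun p ↦ S.indicator (fun h ↦ ℓ (h.2, p.2)) p.1
  have hf : Measurable f := by
    have : f = (Prod.fst ⁻¹' S).indicator fun p ↦ ℓ (p.1.2, p.2) := rfl
    rw [this]
    exact Measurable.indicator (by fun_prop) (hS.preimage measurable_fst)
  have hfω (ω : Trajectory K d) : (history s ⁻¹' S).indicator (fun ω ↦ ℓ (ω s)) ω =
      f (history s ω, (ω s).2) := rfl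
  have hfi (h : (Finset.range s → Fin K × Outcome d) × Fin K) :
      Integrable (fun x ↦ f (h, x)) (ν h.2 : Measure (Outcome d)) := by
    by_cases hS' : h ∈ S
    · simpa only [f, Set.indicator_of_mem hS'] using hint h.2
    · simp only [f, Set.indicator_of_notMem hS']
      exact integrable_zero _ _ _
  have : IsProbabilityMeasure ((alg.law ν).map (history s)) :=
    Measure.isProbabilityMeasure_map hh.aemeasurable
  have hI : Integrable f ((alg.law ν).map (history s) ⊗ₘ
      (armKernel ν).comap Prod.snd measurable_snd) := by
    rw [Measure.integrable_compProd_iff hf.aestronglyMeasurable]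
    refine ⟨Filter.Eventually.of_forall hfi, ?_⟩
    refine Integrable.of_bound (C := ∑ k, ∫ x, ‖ℓ (k, x)‖ ∂(ν k : Measure (Outcome d)))
      ?_ (Filter.Eventually.of_forall fun h ↦ ?_)
    · exact (hf.norm.stronglyMeasurable.integral_kernel_prod_right'
        (κ := (armKernel ν).comap Prod.snd measurable_snd)).aestronglyMeasurable
    · rw [Real.norm_of_nonneg (integral_nonneg fun _ ↦ norm_nonneg _)]
      refine le_trans ?_ (Finset.single_le_sum
        (f := fun k ↦ ∫ x, ‖ℓ (k, x)‖ ∂(ν k : Measure (Outcome d)))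
        (fun k _ ↦ integral_nonneg fun _ ↦ norm_nonneg _) (Finset.mem_univ h.2))
      refine integral_mono (hfi h).norm (hint h.2).norm fun x ↦ ?_
      exact norm_indicator_le_norm_self (fun h ↦ ℓ (h.2, x)) h
  rw [← alg.law_map_history_outcome ν s] at hI
  refine ⟨hI.comp_measurable (by fun_prop), ?_⟩
  simp only [hfω]
  rw [← integral_map (μ := alg.law ν) (φ := fun ω ↦ (history s ω, (ω s).2)) (f := f)
    (by fun_prop) hf.aestronglyMeasurable, law_map_history_outcome,
    Measure.integral_compProd (by rwa [← law_map_history_outcome]), integral_map (by fun_prop)]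
  · refine integral_congr_ae (Filter.Eventually.of_forall fun ω ↦ ?_)
    change ∫ x, f (history s ω, x) ∂(ν (ω s).1 : Measure (Outcome d)) = _
    by_cases hS' : history s ω ∈ S
    · simp only [f, Set.indicator_of_mem hS']
      rw [Set.indicator_of_mem (show ω ∈ history s ⁻¹' S from hS')]
      rfl
    · simp only [f, Set.indicator_of_notMem hS']
      rw [Set.indicator_of_notMem (show ω ∉ history s ⁻¹' S from hS')]
      simp
  · exact (hf.stronglyMeasurable.integral_kernel_prod_right'
      (κ := (armKernel ν).comap Prod.snd measurable_snd)).aestronglyMeasurable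

/-- The expected number of pulls of the arm `k` before `τ`. -/
noncomputable def expectedPulls (k : Fin K) : ℝ≥0∞ :=
  ∑' s : ℕ, alg.law ν {ω | (s : ℕ∞) < alg.τ ω ∧ (ω s).1 = k}

theorem measurableSet_pull (s : ℕ) (k : Fin K) :
    MeasurableSet {ω : Trajectory K d | (s : ℕ∞) < alg.τ ω ∧ (ω s).1 = k} := by
  refine MeasurableSet.inter ((historyFiltration K d).le s _ (alg.measurableSet_lt_stop s)) ?_
  exact measurableSet_eq_fun (f := fun ω : Trajectory K d ↦ (ω s).1) (g := fun _ ↦ k)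
    (by fun_prop) measurable_const

theorem _root_.ENat.toENNReal_eq_tsum (m : ℕ∞) :
    (m : ℝ≥0∞) = ∑' s : ℕ, if (s : ℕ∞) < m then 1 else 0 := by
  induction m with
  | top => simp
  | coe n =>
    rw [tsum_eq_sum (s := Finset.range n)]
    · rw [Finset.sum_congr rfl fun s hs ↦ if_pos (by exact_mod_cast Finset.mem_range.1 hs)]
      simp
    · intro s hs
      rw [if_neg]
      rw [Finset.mem_range] at hs
      exact_mod_cast hs

theorem measurable_ite_lt_stop (s : ℕ) :
    Measurable fun ω : Trajectory K d ↦ if (s : ℕ∞) < alg.τ ω then (1 : ℝ≥0∞) else 0 :=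
  Measurable.ite ((historyFiltration K d).le s _ (alg.measurableSet_lt_stop s)) measurable_const
    measurable_const

theorem sum_expectedPulls : ∑ k, alg.expectedPulls ν k = alg.sampleComplexity ν := by
  unfold expectedPulls sampleComplexity
  rw [← Summable.tsum_finsetSum fun _ _ ↦ ENNReal.summable]
  simp only [ENat.toENNReal_eq_tsum]
  rw [lintegral_tsum fun s ↦ (alg.measurable_ite_lt_stop s).aemeasurable]
  refine tsum_congr fun s ↦ ?_
  have : (fun ω : Trajectory K d ↦ if (s : ℕ∞) < alg.τ ω then (1 : ℝ≥0∞) else 0) =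
      {ω : Trajectory K d | (s : ℕ∞) < alg.τ ω}.indicator 1 := by
    ext ω
    simp [Set.indicator_apply]
  rw [this, lintegral_indicator_one ((historyFiltration K d).le s _ (alg.measurableSet_lt_stop s)),
    ← measure_biUnion_finset]
  · congr 1
    ext ω
    simp
  · intro i _ j _ hij
    refine Set.disjoint_left.2 fun ω h1 h2 ↦ hij (h1.2.symm.trans h2.2)
  · exact fun k _ ↦ alg.measurableSet_pull s k

/-- Wald's identity for the stopped log-likelihood ratio, with the number of pulls before
`min τ n` bounded by the number of pulls before `τ`. -/
theorem integrable_stoppedLLR_and_integral_le {ℓ : Fin K × Outcome d → ℝ} (hℓ : Measurable ℓ)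
    (hint : ∀ k, Integrable (fun x ↦ ℓ (k, x)) (ν k : Measure (Outcome d)))
    (hnn : ∀ k, 0 ≤ ∫ x, ℓ (k, x) ∂(ν k : Measure (Outcome d)))
    (hT : alg.sampleComplexity ν ≠ ∞) (n : ℕ) :
    Integrable (alg.stoppedLLR ℓ n) (alg.law ν) ∧ ∫ ω, alg.stoppedLLR ℓ n ω ∂(alg.law ν) ≤
      ∑ k, (alg.expectedPulls ν k).toReal * ∫ x, ℓ (k, x) ∂(ν k : Measure (Outcome d)) := by
  have h s := alg.integrable_integral_outcome ν hℓ hint s (alg.measurableSet_lt_stop s)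
  refine ⟨integrable_finsetSum _ fun s _ ↦ (h s).1, ?_⟩
  unfold stoppedLLR
  rw [integral_finsetSum _ fun s _ ↦ (h s).1]
  set Δ : Fin K → ℝ := fun k ↦ ∫ x, ℓ (k, x) ∂(ν k : Measure (Outcome d)) with hΔ
  have hfin k : alg.expectedPulls ν k ≠ ∞ := by
    refine ne_top_of_le_ne_top hT ?_
    rw [← sum_expectedPulls]
    exact Finset.single_le_sum (f := alg.expectedPulls ν) (fun _ _ ↦ zero_le) (Finset.mem_univ k)
  have hs (s : ℕ) : ∫ ω, {ω : Trajectory K d | (s : ℕ∞) < alg.τ ω}.indicator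
      (fun ω ↦ ℓ (ω s)) ω ∂(alg.law ν) =
      ∑ k, (alg.law ν).real {ω | (s : ℕ∞) < alg.τ ω ∧ (ω s).1 = k} * Δ k := by
    rw [(h s).2]
    have e (ω : Trajectory K d) : {ω : Trajectory K d | (s : ℕ∞) < alg.τ ω}.indicator
        (fun ω ↦ Δ (ω s).1) ω = ∑ k, {ω : Trajectory K d | (s : ℕ∞) < alg.τ ω ∧
          (ω s).1 = k}.indicator (fun _ ↦ Δ k) ω := by
      classical
      simp only [Set.indicator_apply, Set.mem_ofPred_eq]
      by_cases hω : (s : ℕ∞) < alg.τ ω <;> simp [hω]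
    simp only [hΔ] at e
    simp only [e]
    rw [integral_finsetSum _ fun k _ ↦
      (integrable_const _).indicator (alg.measurableSet_pull s k)]
    refine Finset.sum_congr rfl fun k _ ↦ ?_
    rw [integral_indicator_const _ (alg.measurableSet_pull s k), smul_eq_mul]
  simp only [hs]
  rw [Finset.sum_comm]
  refine Finset.sum_le_sum fun k _ ↦ ?_
  rw [← Finset.sum_mul]
  refine mul_le_mul_of_nonneg_right ?_ (hnn k)
  unfold expectedPulls
  simp only [Measure.real]
  rw [← ENNReal.toReal_sum (fun _ _ ↦ measure_ne_top _ _)]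
  exact ENNReal.toReal_mono (hfin k) (ENNReal.sum_le_tsum _)

end Algorithm
end CPSI

/-! ### The transportation inequality -/

namespace CPSI

namespace Algorithm

variable {K d : ℕ} (alg : Algorithm K d) (ν : Fin K → ProbabilityMeasure (Outcome d))

/-- The event that the algorithm stops at a time `t ≤ n` at which `A t` holds. -/
def stopEvent (A : ℕ → Set (Trajectory K d)) (n : ℕ) : Set (Trajectory K d) :=
  {ω | ∃ t : ℕ, t ≤ n ∧ alg.τ ω = t ∧ ω ∈ A t}

section

variable {A : ℕ → Set (Trajectory K d)}

theorem measurableSet_stopEvent (hA : ∀ t, MeasurableSet[historyFiltration K d t] (A t)) (n : ℕ) :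
    MeasurableSet (alg.stopEvent A n) := by
  have : alg.stopEvent A n = ⋃ t, ⋃ _ : t ≤ n, ({ω | alg.τ ω = t} ∩ A t) := by
    ext ω
    simp only [stopEvent, Set.mem_ofPred_eq, Set.mem_iUnion, Set.mem_inter_iff, exists_prop]
  rw [this]
  exact MeasurableSet.iUnion fun t ↦ MeasurableSet.iUnion fun _ ↦
    (historyFiltration K d).le t _ ((alg.measurableSet_stop_eq t).inter (hA t))

theorem mem_stopEvent_iff {n t : ℕ} (ht : t ≤ n) {ω : Trajectory K d}
    (h : min (alg.τ ω) n = t) : ω ∈ alg.stopEvent A n ↔ alg.τ ω = t ∧ ω ∈ A t := by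
  refine ⟨?_, fun h' ↦ ⟨t, ht, h'⟩⟩
  rintro ⟨u, hu, hτ, hω⟩
  have hu' : (u : ℕ∞) ≤ n := by exact_mod_cast hu
  rw [hτ, min_eq_left hu'] at h
  obtain rfl : u = t := by exact_mod_cast h
  exact ⟨hτ, hω⟩

theorem monotone_stopEvent : Monotone (alg.stopEvent A) :=
  fun _ _ hmn _ ⟨t, ht, h⟩ ↦ ⟨t, ht.trans hmn, h⟩

theorem iUnion_stopEvent :
    ⋃ n, alg.stopEvent A n = {ω | ∃ t : ℕ, alg.τ ω = t ∧ ω ∈ A t} := by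
  ext ω
  simp only [stopEvent, Set.mem_iUnion, Set.mem_ofPred_eq]
  exact ⟨fun ⟨_, t, _, h⟩ ↦ ⟨t, h⟩, fun ⟨t, h⟩ ↦ ⟨t, t, le_rfl, h⟩⟩

/-- Change of measure for a variable that takes the value `e ^ a` on an event of `F_{min τ n}`
and `e ^ (-a)` outside. -/
theorem integrable_exp_and_integral_le_one (ν' : Fin K → ProbabilityMeasure (Outcome d))
    {ℓ : Fin K × Outcome d → ℝ} (hℓ : Measurable ℓ)
    (hν' : ∀ k, (ν' k : Measure (Outcome d)) = (ν k : Measure (Outcome d)).withDensity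
      fun x ↦ ENNReal.ofReal (Real.exp (-ℓ (k, x))))
    (hA : ∀ t, MeasurableSet[historyFiltration K d t] (A t)) (n : ℕ) {δ : ℝ}
    (hδ : 0 < δ) (hδ' : δ < 1 / 2) (h' : (alg.law ν').real (alg.stopEvent A n) ≤ δ)
    {φ : Trajectory K d → ℝ} (hφ : Measurable φ)
    (hφ1 : ∀ ω ∈ alg.stopEvent A n, φ ω = Real.log ((1 - δ) / δ))
    (hφ2 : ∀ ω ∉ alg.stopEvent A n, φ ω = -Real.log ((1 - δ) / δ)) :
    Integrable (fun ω ↦ Real.exp (φ ω - alg.stoppedLLR ℓ n ω)) (alg.law ν) ∧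
      ∫ ω, Real.exp (φ ω - alg.stoppedLLR ℓ n ω) ∂(alg.law ν) ≤ 1 := by
  have hδ1 : 0 < 1 - δ := by linarith
  set E := alg.stopEvent A n with hE
  have hEm : MeasurableSet E := alg.measurableSet_stopEvent hA n
  have hD : Measurable (alg.stoppedLLR ℓ n) := alg.measurable_stoppedLLR hℓ n
  have c1 : alg.law ν' E =
      ∫⁻ ω in E, ENNReal.ofReal (Real.exp (-alg.stoppedLLR ℓ n ω)) ∂(alg.law ν) := by
    refine alg.law_apply_change_stopped ν ν' hℓ hν' n fun t ht ↦ ?_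
    have : {ω | min (alg.τ ω) n = t} ∩ E =
        {ω | min (alg.τ ω) n = t} ∩ ({ω | alg.τ ω = t} ∩ A t) := by
      ext ω
      exact and_congr_right fun h ↦ alg.mem_stopEvent_iff ht h
    rw [this]
    exact (alg.measurableSet_min_stop_eq ht).inter ((alg.measurableSet_stop_eq t).inter (hA t))
  have c2 : alg.law ν' Eᶜ =
      ∫⁻ ω in Eᶜ, ENNReal.ofReal (Real.exp (-alg.stoppedLLR ℓ n ω)) ∂(alg.law ν) := by
    refine alg.law_apply_change_stopped ν ν' hℓ hν' n fun t ht ↦ ?_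
    have : {ω | min (alg.τ ω) n = t} ∩ Eᶜ =
        {ω | min (alg.τ ω) n = t} \ ({ω | alg.τ ω = t} ∩ A t) := by
      ext ω
      exact and_congr_right fun h ↦ not_congr (alg.mem_stopEvent_iff ht h)
    rw [this]
    exact (alg.measurableSet_min_stop_eq ht).diff ((alg.measurableSet_stop_eq t).inter (hA t))
  have hexp : Real.exp (Real.log ((1 - δ) / δ)) = (1 - δ) / δ := Real.exp_log (by positivity)
  have hexp' : Real.exp (-Real.log ((1 - δ) / δ)) = δ / (1 - δ) := by
    rw [Real.exp_neg, hexp, inv_div]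
  have hm : Measurable fun ω ↦ Real.exp (φ ω - alg.stoppedLLR ℓ n ω) := by fun_prop
  have hle : ∫⁻ ω, ENNReal.ofReal (Real.exp (φ ω - alg.stoppedLLR ℓ n ω)) ∂(alg.law ν) ≤ 1 := by
    have d1 : ∫⁻ ω in E, ENNReal.ofReal (Real.exp (φ ω - alg.stoppedLLR ℓ n ω)) ∂(alg.law ν) =
        ENNReal.ofReal ((1 - δ) / δ) * alg.law ν' E := by
      rw [c1, ← lintegral_const_mul _ (by fun_prop)]
      refine setLIntegral_congr_fun hEm fun ω hω ↦ ?_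
      rw [sub_eq_add_neg, Real.exp_add, ENNReal.ofReal_mul (Real.exp_nonneg _), hφ1 ω hω, hexp]
    have d2 : ∫⁻ ω in Eᶜ, ENNReal.ofReal (Real.exp (φ ω - alg.stoppedLLR ℓ n ω)) ∂(alg.law ν) =
        ENNReal.ofReal (δ / (1 - δ)) * alg.law ν' Eᶜ := by
      rw [c2, ← lintegral_const_mul _ (by fun_prop)]
      refine setLIntegral_congr_fun hEm.compl fun ω hω ↦ ?_
      rw [sub_eq_add_neg, Real.exp_add, ENNReal.ofReal_mul (Real.exp_nonneg _), hφ2 ω hω, hexp']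
    rw [← lintegral_add_compl _ hEm, d1, d2, ← ofReal_measureReal (s := E),
      ← ofReal_measureReal (s := Eᶜ), probReal_compl_eq_one_sub hEm,
      ← ENNReal.ofReal_mul (by positivity), ← ENNReal.ofReal_mul (by positivity),
      ← ENNReal.ofReal_add (by positivity)
        (mul_nonneg (by positivity) (sub_nonneg.2 measureReal_le_one)), ENNReal.ofReal_le_one]
    set q := (alg.law ν').real E
    have : (1 - δ) / δ * q + δ / (1 - δ) * (1 - q) - 1 =
        -((1 - 2 * δ) * (δ - q) / (δ * (1 - δ))) := by
      field_simp
      ring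
    have : 0 ≤ (1 - 2 * δ) * (δ - q) / (δ * (1 - δ)) :=
      div_nonneg (mul_nonneg (by linarith) (by linarith)) (by positivity)
    linarith
  have hnn : ∀ ω, 0 ≤ Real.exp (φ ω - alg.stoppedLLR ℓ n ω) := fun ω ↦ Real.exp_nonneg _
  refine ⟨⟨hm.aestronglyMeasurable, ?_⟩, ?_⟩
  · rw [hasFiniteIntegral_iff_ofReal (Filter.Eventually.of_forall hnn)]
    exact hle.trans_lt ENNReal.one_lt_top
  · rw [integral_eq_lintegral_of_nonneg_ae (Filter.Eventually.of_forall hnn)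
      hm.aestronglyMeasurable]
    exact ENNReal.toReal_le_of_le_ofReal zero_le_one (by simpa using hle)

/-- The transportation inequality between two bandits, for an event of probability at least `1 - δ`
on the first and at most `δ` on the second. It follows from integrating
`1 + φ - S ≤ exp (φ - S)` on `ν`, with `S` the log-likelihood ratio up to the time `min τ n`
and `φ` the log-likelihood ratio of the Bernoulli distributions of means `1 - δ` and `δ`
evaluated at the event. -/
theorem transportation (ν' : Fin K → ProbabilityMeasure (Outcome d))
    {ℓ : Fin K × Outcome d → ℝ} (hℓ : Measurable ℓ)
    (hν' : ∀ k, (ν' k : Measure (Outcome d)) = (ν k : Measure (Outcome d)).withDensity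
      fun x ↦ ENNReal.ofReal (Real.exp (-ℓ (k, x))))
    (hint : ∀ k, Integrable (fun x ↦ ℓ (k, x)) (ν k : Measure (Outcome d)))
    (hnn : ∀ k, 0 ≤ ∫ x, ℓ (k, x) ∂(ν k : Measure (Outcome d)))
    (hT : alg.sampleComplexity ν ≠ ∞)
    (hA : ∀ t, MeasurableSet[historyFiltration K d t] (A t)) {δ : ℝ}
    (hδ : 0 < δ) (hδ' : δ < 1 / 2)
    (h : 1 - δ ≤ (alg.law ν).real {ω | ∃ t : ℕ, alg.τ ω = t ∧ ω ∈ A t})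
    (h' : (alg.law ν').real {ω | ∃ t : ℕ, alg.τ ω = t ∧ ω ∈ A t} ≤ δ) :
    (1 - 2 * δ) * Real.log ((1 - δ) / δ) ≤
      ∑ k, (alg.expectedPulls ν k).toReal * ∫ x, ℓ (k, x) ∂(ν k : Measure (Outcome d)) := by
  set a := Real.log ((1 - δ) / δ) with ha
  have ha0 : 0 ≤ a := Real.log_nonneg (by rw [le_div_iff₀ hδ]; linarith)
  set R := ∑ k, (alg.expectedPulls ν k).toReal * ∫ x, ℓ (k, x) ∂(ν k : Measure (Outcome d))
  have hn (n : ℕ) : (2 * (alg.law ν).real (alg.stopEvent A n) - 1) * a ≤ R := by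
    have hEm : MeasurableSet (alg.stopEvent A n) := alg.measurableSet_stopEvent hA n
    let φ : Trajectory K d → ℝ := fun ω ↦ (alg.stopEvent A n).indicator (fun _ ↦ 2 * a) ω - a
    have hφ : Measurable φ := (measurable_const.indicator hEm).sub measurable_const
    have hφi : Integrable φ (alg.law ν) :=
      ((integrable_const _).indicator hEm).sub (integrable_const _)
    have hle : (alg.law ν').real (alg.stopEvent A n) ≤ δ := by
      refine (measureReal_mono ?_).trans h'
      rw [← iUnion_stopEvent]
      exact Set.subset_iUnion _ n
    obtain ⟨i1, i2⟩ := alg.integrable_exp_and_integral_le_one ν ν' hℓ hν' hA n hδ hδ' hle hφ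
      (fun ω hω ↦ by simp only [φ, Set.indicator_of_mem hω]; ring)
      (fun ω hω ↦ by simp only [φ, Set.indicator_of_notMem hω]; ring)
    obtain ⟨j1, j2⟩ := alg.integrable_stoppedLLR_and_integral_le ν hℓ hint hnn hT n
    have h1 : ∫ ω, (φ ω - alg.stoppedLLR ℓ n ω + 1) ∂(alg.law ν) ≤
        ∫ ω, Real.exp (φ ω - alg.stoppedLLR ℓ n ω) ∂(alg.law ν) :=
      integral_mono ((hφi.sub j1).add (integrable_const 1)) i1 fun ω ↦ Real.add_one_le_exp _
    have h2 : ∫ ω, φ ω ∂(alg.law ν) =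
        (alg.law ν).real (alg.stopEvent A n) * (2 * a) - a := by
      rw [integral_sub ((integrable_const _).indicator hEm) (integrable_const _),
        integral_indicator_const _ hEm]
      simp
    have h3 : ∫ ω, (φ ω - alg.stoppedLLR ℓ n ω + 1) ∂(alg.law ν) =
        ∫ ω, (φ ω - alg.stoppedLLR ℓ n ω) ∂(alg.law ν) + ∫ _, 1 ∂(alg.law ν) :=
      integral_add (hφi.sub j1) (integrable_const 1)
    rw [h3, integral_sub hφi j1, h2] at h1
    simp only [integral_const, probReal_univ, smul_eq_mul, mul_one] at h1
    linarith
  have hlim : Filter.Tendsto (fun n ↦ (alg.law ν).real (alg.stopEvent A n)) Filter.atTop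
      (nhds ((alg.law ν).real {ω | ∃ t : ℕ, alg.τ ω = t ∧ ω ∈ A t})) := by
    rw [← iUnion_stopEvent]
    exact (ENNReal.tendsto_toReal (measure_ne_top _ _)).comp
      (tendsto_measure_iUnion_atTop alg.monotone_stopEvent)
  have := le_of_tendsto (((hlim.const_mul 2).sub_const 1).mul_const a)
    (Filter.Eventually.of_forall hn)
  refine le_trans ?_ this
  exact mul_le_mul_of_nonneg_right (by linarith) ha0

end

theorem ae_stop_ne_top (hT : alg.sampleComplexity ν ≠ ∞) : ∀ᵐ ω ∂(alg.law ν), alg.τ ω ≠ ⊤ := by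
  have hm : Measurable fun ω ↦ (alg.τ ω : ℝ≥0∞) := by
    simp only [ENat.toENNReal_eq_tsum]
    exact Measurable.tsum alg.measurable_ite_lt_stop
  filter_upwards [ae_lt_top hm hT] with ω hω
  exact (ENat.toENNReal_lt_top.1 hω).ne

end Algorithm

/-! ### The lower bound for Gaussian bandits -/

/-- The bandit whose arms are the Gaussians with means `l` and identity covariance. -/
noncomputable def gaussianBandit {K d : ℕ} (l : Fin K → Outcome d) :
    Fin K → ProbabilityMeasure (Outcome d) :=
  fun k ↦ ⟨multivariateGaussian (l k) 1, inferInstance⟩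

theorem coe_gaussianBandit {K d : ℕ} (l : Fin K → Outcome d) (k : Fin K) :
    (gaussianBandit l k : Measure (Outcome d)) = multivariateGaussian (l k) 1 := rfl

theorem gaussianBandit_mem {K d : ℕ} (l : Fin K → Outcome d) (k : Fin K) :
    gaussianBandit l k ∈ gaussianClass d := ⟨l k, rfl⟩

theorem means_gaussianBandit {K d : ℕ} (l : Fin K → Outcome d) : means (gaussianBandit l) = l :=
  funext fun _ ↦ integral_id_multivariateGaussian

theorem eq_gaussianBandit_means {K d : ℕ} {ν : Fin K → ProbabilityMeasure (Outcome d)}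
    (hν : ∀ k, ν k ∈ gaussianClass d) : ν = gaussianBandit (means ν) := by
  have h : ∃ l, ν = gaussianBandit l := by
    choose l hl using hν
    exact ⟨l, funext fun k ↦ Subtype.ext (hl k)⟩
  obtain ⟨l, rfl⟩ := h
  rw [means_gaussianBandit]

/-- The transportation inequality between a Gaussian bandit and an alternative `l`, for the event
that the algorithm stops and recommends `O*(μ)`: this is a mistake on `l`, and its complement
is a mistake on `μ` up to the null event that the algorithm does not stop. -/
theorem log_le_sum_expectedPulls {K d : ℕ} {P : Set (Outcome d)} {δ : ℝ} (hδ : 0 < δ)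
    (hδ' : δ < 1 / 2) {alg : Algorithm K d} (halg : alg.IsDeltaCorrect P (gaussianClass d) δ)
    {μ l : Fin K → Outcome d} (hl : l ∈ alt P (optSet P μ))
    (hT : alg.sampleComplexity (gaussianBandit μ) ≠ ∞) :
    Real.log (1 / (2.4 * δ)) ≤
      ∑ k, (alg.expectedPulls (gaussianBandit μ) k).toReal * (‖μ k - l k‖ ^ 2 / 2) := by
  have hm : Measurable fun p : Fin K × Outcome d ↦ gaussianLLR (μ p.1) (l p.1) p.2 :=
    measurable_from_prod_countable_right fun k ↦ measurable_gaussianLLR (μ k) (l k)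
  have hmean (k : Fin K) :
      ∫ x, gaussianLLR (μ k) (l k) x ∂(gaussianBandit μ k : Measure (Outcome d)) =
      ‖μ k - l k‖ ^ 2 / 2 := by rw [coe_gaussianBandit, integral_gaussianLLR]
  have hμ := halg (gaussianBandit μ) (gaussianBandit_mem μ)
  have hl' := halg (gaussianBandit l) (gaussianBandit_mem l)
  rw [means_gaussianBandit] at hμ hl'
  have key := alg.transportation (gaussianBandit μ) (gaussianBandit l) hm
    (fun k ↦ by
      rw [coe_gaussianBandit, coe_gaussianBandit]
      exact multivariateGaussian_one_eq_withDensity (μ k) (l k))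
    (fun k ↦ by
      rw [coe_gaussianBandit]
      exact integrable_gaussianLLR (μ k) (l k)) (fun k ↦ by rw [hmean]; positivity) hT
    (A := fun t ↦ {ω | alg.guess t ω = optSet P μ}) (fun t ↦ alg.guess_measurable t _) hδ hδ' ?_ ?_
  · simp only [hmean] at key
    exact (log_le_binary_entropy hδ hδ').trans key
  · have h1 : 1 ≤ alg.law (gaussianBandit μ)
        {ω | ∃ t : ℕ, alg.τ ω = t ∧ ω ∈ {ω | alg.guess t ω = optSet P μ}} + ENNReal.ofReal δ := by
      refine le_trans ?_ (add_le_add_right hμ _)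
      refine le_trans ?_ (measure_union_le _ _)
      rw [← measure_univ (μ := alg.law (gaussianBandit μ))]
      refine measure_mono_ae ?_
      filter_upwards [alg.ae_stop_ne_top _ hT] with ω hω _
      obtain ⟨t, ht⟩ := ENat.ne_top_iff_exists.1 hω
      by_cases hg : alg.guess t ω = optSet P μ
      · exact Or.inl ⟨t, ht.symm, hg⟩
      · exact Or.inr ⟨t, ht.symm, hg⟩
    have h2 := ENNReal.toReal_mono (by finiteness) h1
    rw [ENNReal.toReal_add (by finiteness) (by finiteness), ENNReal.toReal_ofReal hδ.le,
      ENNReal.toReal_one] at h2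
    rw [Measure.real]
    linarith
  · rw [Measure.real]
    refine ENNReal.toReal_le_of_le_ofReal hδ.le ((measure_mono ?_).trans hl')
    rintro ω ⟨t, ht, hg⟩
    exact ⟨t, ht, fun h ↦ hl (h.symm.trans hg)⟩

theorem exists_isMaxOn_altCost {K d : ℕ} (hK : 1 ≤ K) (P : Set (Outcome d))
    (μ : Fin K → Outcome d) :
    ∃ w ∈ stdSimplex ℝ (Fin K), IsMaxOn (altCost P μ) (stdSimplex ℝ (Fin K)) w := by
  refine UpperSemicontinuousOn.exists_isMaxOn ⟨_, single_mem_stdSimplex ℝ (⟨0, hK⟩ : Fin K)⟩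
    (isCompact_stdSimplex ℝ _) (UpperSemicontinuous.upperSemicontinuousOn ?_ _)
  refine upperSemicontinuous_biInf fun l _ ↦ Continuous.upperSemicontinuous ?_
  exact ENNReal.continuous_ofReal.comp (by fun_prop)

/-- The lower bound in `[0, ∞]`, for a finite sample complexity and a positive logarithm. The
proportions of pulls are a point of the simplex at which `altCost` is at least
`log (1 / (2.4 δ)) / E[τ]`. -/
theorem charTime_mul_le {K d : ℕ} {P : Set (Outcome d)} {δ : ℝ} (hδ : 0 < δ)
    (hδ' : δ < 1 / 2) {alg : Algorithm K d} (halg : alg.IsDeltaCorrect P (gaussianClass d) δ)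
    {μ : Fin K → Outcome d} (hL : 0 < Real.log (1 / (2.4 * δ)))
    (hT : alg.sampleComplexity (gaussianBandit μ) ≠ ∞) (hK : 1 ≤ K) :
    charTime P μ * ENNReal.ofReal (Real.log (1 / (2.4 * δ))) ≤
      alg.sampleComplexity (gaussianBandit μ) := by
  set L := Real.log (1 / (2.4 * δ))
  set T := alg.sampleComplexity (gaussianBandit μ) with hTdef
  set e := alg.expectedPulls (gaussianBandit μ) with he
  have hsum : ∑ k, e k = T := alg.sum_expectedPulls _
  have hfin k : e k ≠ ∞ := by
    refine ne_top_of_le_ne_top hT ?_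
    rw [← hsum]
    exact Finset.single_le_sum (f := e) (fun _ _ ↦ zero_le) (Finset.mem_univ k)
  have hsum' : ∑ k, (e k).toReal = T.toReal := by
    rw [← hsum, ENNReal.toReal_sum fun k _ ↦ hfin k]
  rcases (alt P (optSet P μ)).eq_empty_or_nonempty with hempty | ⟨l₀, hl₀⟩
  · have hw := single_mem_stdSimplex ℝ (⟨0, hK⟩ : Fin K)
    have htop : ⨆ w ∈ stdSimplex ℝ (Fin K), altCost P μ w = ⊤ := by
      refine top_le_iff.1 (le_trans ?_ (le_iSup₂ (f := fun w _ ↦ altCost P μ w) _ hw))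
      simp [altCost, hempty]
    simp [charTime, htop]
  have hT0 : 0 < T.toReal := by
    refine lt_of_le_of_ne ENNReal.toReal_nonneg fun h0 ↦ ?_
    have hz : ∀ k, (e k).toReal = 0 := fun k ↦
      (Finset.sum_eq_zero_iff_of_nonneg fun _ _ ↦ ENNReal.toReal_nonneg).1
        (hsum'.trans h0.symm) k (Finset.mem_univ k)
    have := log_le_sum_expectedPulls hδ hδ' halg hl₀ hT
    rw [← he] at this
    simp only [hz, zero_mul, Finset.sum_const_zero] at this
    exact absurd this (not_le.2 hL)
  have hw : (fun k ↦ (e k).toReal / T.toReal) ∈ stdSimplex ℝ (Fin K) := by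
    refine ⟨fun k ↦ by positivity, ?_⟩
    rw [← Finset.sum_div, hsum', div_self hT0.ne']
  have hcost : ENNReal.ofReal L / T ≤ altCost P μ fun k ↦ (e k).toReal / T.toReal := by
    refine le_iInf₂ fun l hl ↦ ?_
    rw [← ENNReal.ofReal_toReal hT, ← ENNReal.ofReal_div_of_pos hT0]
    refine ENNReal.ofReal_le_ofReal ?_
    rw [div_le_iff₀ hT0, Finset.sum_mul]
    refine (log_le_sum_expectedPulls hδ hδ' halg hl hT).trans_eq ?_
    refine Finset.sum_congr rfl fun k _ ↦ ?_
    rw [ENNReal.toReal_ofReal hT0.le]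
    rw [he]
    field_simp
  have hle : charTime P μ ≤ T / ENNReal.ofReal L := by
    rw [← ENNReal.inv_div (Or.inr ENNReal.ofReal_ne_top)
      (Or.inr (ENNReal.ofReal_pos.2 hL).ne')]
    exact ENNReal.inv_le_inv.2 (hcost.trans (le_iSup₂ (f := fun w _ ↦ altCost P μ w) _ hw))
  exact ENNReal.mul_le_of_le_div hle

end CPSI

theorem proposition1 {K d m : ℕ} (hK : 1 ≤ K) (hd : 1 ≤ d)
    (A : Matrix (Fin m) (Fin d) ℝ) (b : Fin m → ℝ)
    (δ : ℝ) (hδ₀ : 0 < δ) (hδ₁ : δ < 1)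
    (alg : CPSI.Algorithm K d)
    (halg : alg.IsDeltaCorrect (CPSI.polyhedron A b) (CPSI.gaussianClass d) δ)
    (ν : Fin K → ProbabilityMeasure (CPSI.Outcome d)) (hν : ∀ k, ν k ∈ CPSI.gaussianClass d) :
    IsGreatest (CPSI.altCost (CPSI.polyhedron A b) (CPSI.means ν) '' stdSimplex ℝ (Fin K))
        (CPSI.charTime (CPSI.polyhedron A b) (CPSI.means ν))⁻¹ ∧
      (CPSI.charTime (CPSI.polyhedron A b) (CPSI.means ν) : EReal) *
          ((Real.log (1 / (2.4 * δ)) : ℝ) : EReal) ≤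
        (alg.sampleComplexity ν : EReal) := by
  refine ⟨?_, ?_⟩
  · obtain ⟨w, hw, hmax⟩ := CPSI.exists_isMaxOn_altCost hK (CPSI.polyhedron A b) (CPSI.means ν)
    have hsup : (CPSI.charTime (CPSI.polyhedron A b) (CPSI.means ν))⁻¹ =
        CPSI.altCost (CPSI.polyhedron A b) (CPSI.means ν) w := by
      rw [CPSI.charTime, inv_inv]
      exact le_antisymm (iSup₂_le fun v hv ↦ hmax hv)
        (le_iSup₂ (f := fun v _ ↦ CPSI.altCost (CPSI.polyhedron A b) (CPSI.means ν) v) w hw)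
    rw [hsup]
    refine ⟨Set.mem_image_of_mem _ hw, ?_⟩
    rintro _ ⟨v, hv, rfl⟩
    exact hmax hv
  · rcases le_or_gt (Real.log (1 / (2.4 * δ))) 0 with hL | hL
    · refine le_trans ?_ (EReal.coe_ennreal_nonneg _)
      exact EReal.mul_nonpos_iff.2 (Or.inl ⟨EReal.coe_ennreal_nonneg _, by exact_mod_cast hL⟩)
    by_cases hT : alg.sampleComplexity ν = ∞
    · rw [hT]
      exact le_top
    have hδ' : δ < 1 / 2 := by
      have h1 := (Real.log_pos_iff (by positivity)).1 hL
      rw [lt_div_iff₀ (by positivity)] at h1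
      linarith
    rw [CPSI.eq_gaussianBandit_means hν, CPSI.means_gaussianBandit] at *
    have := CPSI.charTime_mul_le hδ₀ hδ' halg hL hT hK
    rw [← EReal.coe_ennreal_le_coe_ennreal_iff, EReal.coe_ennreal_mul, EReal.coe_ennreal_ofReal,
      max_eq_left hL.le] at this
    exact this
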